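/- A \emph{parking function of size $n$} is represented as a labeled Dyck path: a lattice path from $(0,0)$ to $(n,n)$ with $n$ unit north steps and $n$ unit east steps that never goes below the line $y=x$, whose north steps are labeled bijectively by $1,\dots,n$ so that the labels increase along consecutive north steps (the labels on the line $x=i$ are the cars that prefer spot $i+1$). Reading the labels of the north steps of $p$ in order gives a permutation $\phi(p)$ of $\{1,\dots,n\}$. A permutation $\pi$ avoids a pattern $\rho$ of length $m$ if there are no positions $i_1<\dots<i_m$ such that, for all $a,b$, $\pi_{i_a}\le\pi_{i_b}$ if and only if $\rho_a\le\rho_b$. Let $\mathrm{pf}_n(123,132,213)$ be the number of parking functions $p$ of size $n$ such that $\phi(p)$ avoids each of the patterns $123$, $132$ and $213$. \textbf{Theorem.} For every integer $n\ge 0$, $\mathrm{pf}_n(123,132,213)$ is equal to the number of rooted ordered trees with $n+1$ edges in which every vertex is a leaf or adjacent to a leaf, where a leaf is a vertex without children (so the root of a tree with at least one edge is not a leaf). -/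

import Mathlib

namespace PatternParking

/-! ### Patterns in words -/

/-- The word `w` contains the pattern `ρ`: there are positions `i₁ < ⋯ < iₘ` of `w`
(where `m` is the length of `ρ`) such that `w` at `i_a` is at most `w` at `i_b` if and only if
`ρ_a ≤ ρ_b`. -/
def Contains (w ρ : List ℕ) : Prop :=
  ∃ f : Fin ρ.length → Fin w.length, StrictMono f ∧
    ∀ a b : Fin ρ.length, w.get (f a) ≤ w.get (f b) ↔ ρ.get a ≤ ρ.get b

/-- The word `w` avoids the pattern `ρ`. -/
def Avoids (w ρ : List ℕ) : Prop := ¬ Contains w ρ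

/-! ### Parking functions as labeled Dyck paths -/

/-- A step of a labeled lattice path: a north step carrying a label, or an east step. -/
inductive Step : Type
  | north (label : ℕ) : Step
  | east : Step

/-- The label of a north step. -/
def Step.label? : Step → Option ℕ
  | .north a => some a
  | .east => none

/-- Is the step an east step? -/
def Step.isEast : Step → Bool
  | .north _ => false
  | .east => true

/-- The word of the labels of the north steps of a path, in the order of the path. -/
def labels (p : List Step) : List ℕ := p.filterMap Step.label?

/-- The number of north steps of a path. -/
def numNorth (p : List Step) : ℕ := p.countP (fun s => !s.isEast)

/-- The number of east steps of a path. -/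
def numEast (p : List Step) : ℕ := p.countP Step.isEast

/-- `p` is a parking function of size `n`, represented as a labeled Dyck path: a lattice path from
`(0,0)` to `(n,n)` with north and east steps that never goes below the line `y = x`, whose north
steps are labeled bijectively by `1, …, n`, with labels increasing along consecutive north
steps. -/
structure IsParkingFunction (n : ℕ) (p : List Step) : Prop where
  numNorth_eq : numNorth p = n
  numEast_eq : numEast p = n
  numEast_le : ∀ q : List Step, q <+: p → numEast q ≤ numNorth q
  labels_perm : (labels p).Perm (List.range' 1 n)
  increasing : ∀ (q r : List Step) (a b : ℕ), p = q ++ .north a :: .north b :: r → a < b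

/-- The number of parking functions `p` of size `n` such that the permutation obtained by reading
the labels of the north steps of `p` in order avoids every pattern of the list `P`. -/
noncomputable def pf (n : ℕ) (P : List (List ℕ)) : ℕ :=
  Set.ncard {p : List Step | IsParkingFunction n p ∧ ∀ ρ ∈ P, Avoids (labels p) ρ}

/-! ### Rooted ordered trees -/

/-- A (finite, nonempty) rooted ordered tree: a root with the list of the subtrees hanging from
it. -/
inductive OrderedTree : Type
  | node (children : List OrderedTree) : OrderedTree

namespace OrderedTree

/-- The subtrees hanging from the root, from left to right. -/
def children : OrderedTree → List OrderedTree
  | node cs => cs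

/-- The number of edges: every child of the root contributes the edge to the root and the edges
of its own subtree. -/
def numEdges : OrderedTree → ℕ
  | node cs => (cs.map (fun t => numEdges t + 1)).sum

/-- The subtree below the vertex with a given address, if there is such a vertex. The root has the
empty address, and the `i`-th child (from `0`) of the vertex with address `v` has address
`v ++ [i]`. -/
def subtreeAt : OrderedTree → List ℕ → Option OrderedTree
  | t, [] => some t
  | t, i :: v => t.children[i]?.bind (fun s => subtreeAt s v)

/-- The vertices of a tree, given by their addresses. -/
def IsVertex (t : OrderedTree) (v : List ℕ) : Prop := ∃ s, t.subtreeAt v = some s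

/-- A leaf is a vertex without children. -/
def IsLeaf (t : OrderedTree) (v : List ℕ) : Prop :=
  t.IsVertex v ∧ ∀ i : ℕ, ¬ t.IsVertex (v ++ [i])

/-- Two vertices are adjacent if one of them is a child of the other. -/
def Adj (t : OrderedTree) (u v : List ℕ) : Prop :=
  t.IsVertex u ∧ t.IsVertex v ∧ ∃ i : ℕ, v = u ++ [i] ∨ u = v ++ [i]

end OrderedTree

end PatternParking

namespace PatternParking

/-! ### Codes -/

/-! Both sides are decomposed by the same pair of recursions and so are in bijection with `Code
false`.

Trees: every inner vertex must have a leaf among its children. Splitting off the first tree of the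
forest below a vertex leads to two classes, forests with a one-vertex tree (P) and forests without
(Q). They satisfy the two recursions, where the size in P leaves one leaf uncounted
(`Code.toForest`, `ncard_dense_trees`).

Parking functions: 123, 132, 213 are the patterns of length 3 whose first entry is below the last.
Avoiding them means that each letter exceeds all letters at distance at least two to its right, so
the word is a decreasing sequence of blocks of one or two consecutive integers (`layered_iff`). The
block sizes determine the labels. Labels increase only inside a block, so an east step must separate
consecutive blocks, while the two steps of a block may or may not be adjacent. This is a Dyck path
with a three-phase automaton (`exists_toPath_eq`, `follows_toPath`). Balanced words from `ready` to
`ready` form P and those from `pending` to `pending` form Q; cutting at first or last returns gives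
the recursions (`Code.exists_toWord_eq`, `Code.toWord_injective`). -/

/-- Codes for the objects counted on both sides: `Code false` satisfies
`P = 1 + z P + z² P P + z² Q P`, and `Code true` satisfies `Q = 1 + z² Q P`. -/
inductive Code : Bool → Type
  | nil (b : Bool) : Code b
  | single : Code false → Code false
  | double : Code false → Code false → Code false
  | split : Code true → Code false → Code false
  | cons : Code true → Code false → Code true

/-- The size of a code. -/
def Code.size : {b : Bool} → Code b → ℕ
  | _, .nil _ => 0
  | _, .single p => p.size + 1
  | _, .double p q => p.size + q.size + 2
  | _, .split e p => e.size + p.size + 2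
  | _, .cons e p => e.size + p.size + 2

/-! ### Trees -/

namespace OrderedTree

theorem subtreeAt_nil (t : OrderedTree) : t.subtreeAt [] = some t := by
  cases t; simp [subtreeAt]

theorem subtreeAt_cons (t : OrderedTree) (i : ℕ) (v : List ℕ) :
    t.subtreeAt (i :: v) = t.children[i]?.bind (fun s => s.subtreeAt v) := by
  simp [subtreeAt]

theorem subtreeAt_append_singleton (t : OrderedTree) (v : List ℕ) (i : ℕ) :
    t.subtreeAt (v ++ [i]) = (t.subtreeAt v).bind (fun s => s.children[i]?) := by
  induction v generalizing t with
  | nil =>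
    simp only [List.nil_append, subtreeAt_cons, subtreeAt_nil, Option.bind_some]
    cases t.children[i]? <;> rfl
  | cons j v ih =>
    simp only [List.cons_append, subtreeAt_cons, ih]
    cases t.children[j]? <;> rfl

theorem isLeaf_iff (t : OrderedTree) (v : List ℕ) :
    t.IsLeaf v ↔ t.subtreeAt v = some (node []) := by
  constructor
  · rintro ⟨⟨⟨cs⟩, hs⟩, h⟩
    cases cs with
    | nil => exact hs
    | cons c cs =>
      exact absurd ⟨c, by simp [subtreeAt_append_singleton, hs, children]⟩ (h 0)
  · intro h
    refine ⟨⟨_, h⟩, ?_⟩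
    rintro i ⟨s, hs⟩
    simp [subtreeAt_append_singleton, h, children] at hs

/-- Every vertex of the tree is a leaf or has a leaf among its children. -/
inductive Dense : OrderedTree → Prop
  | leaf : Dense (node [])
  | inner (cs : List OrderedTree) : node [] ∈ cs → (∀ t ∈ cs, Dense t) → Dense (node cs)

/-- A parent is never a leaf, so an adjacent leaf is a child. The condition thus depends only on the
subtree below each vertex, which makes it recursive. -/
theorem leaf_or_adj_leaf_iff (t : OrderedTree) :
    (∀ v : List ℕ, t.IsVertex v → t.IsLeaf v ∨ ∃ u : List ℕ, t.Adj v u ∧ t.IsLeaf u) ↔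
      ∀ v s, t.subtreeAt v = some s → s = node [] ∨ node [] ∈ s.children := by
  refine forall_congr' fun v => ?_
  constructor
  · intro h s hs
    rcases h ⟨s, hs⟩ with h | ⟨u, ⟨hv, hu, i, rfl | rfl⟩, hl⟩
    · rw [isLeaf_iff, hs] at h
      exact .inl (Option.some.inj h)
    · rw [isLeaf_iff, subtreeAt_append_singleton, hs] at hl
      exact .inr (List.mem_of_getElem? hl)
    · exact absurd hv (hl.2 i)
  · rintro h ⟨s, hs⟩
    rcases h s hs with rfl | h
    · exact .inl ((isLeaf_iff _ _).2 hs)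
    · obtain ⟨i, hi⟩ := List.mem_iff_getElem?.1 h
      have hu : t.subtreeAt (v ++ [i]) = some (node []) := by
        rw [subtreeAt_append_singleton, hs]; exact hi
      exact .inr ⟨v ++ [i], ⟨⟨s, hs⟩, ⟨_, hu⟩, i, .inl rfl⟩, (isLeaf_iff _ _).2 hu⟩

theorem Dense.of_forall_subtreeAt : (t : OrderedTree) →
    (∀ v s, t.subtreeAt v = some s → s = node [] ∨ node [] ∈ s.children) → Dense t
  | node cs, h => by
    rcases h [] _ (subtreeAt_nil _) with h0 | h0
    · rw [h0]; exact .leaf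
    · refine .inner cs h0 fun t ht => Dense.of_forall_subtreeAt t fun v s hs => ?_
      obtain ⟨i, hi⟩ := List.mem_iff_getElem?.1 ht
      refine h (i :: v) s ?_
      rw [subtreeAt_cons, children, hi]
      exact hs

theorem Dense.forall_subtreeAt {t : OrderedTree} (ht : Dense t) (v : List ℕ) (s : OrderedTree)
    (hs : t.subtreeAt v = some s) : s = node [] ∨ node [] ∈ s.children := by
  induction v generalizing t with
  | nil =>
    rw [subtreeAt_nil] at hs
    cases hs
    cases ht with
    | leaf => exact .inl rfl
    | inner cs h _ => exact .inr h
  | cons i v ih =>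
    rw [subtreeAt_cons, Option.bind_eq_some_iff] at hs
    obtain ⟨c, hc, hs⟩ := hs
    cases ht with
    | leaf => simp [children] at hc
    | inner cs _ h => exact ih (h c (List.mem_of_getElem? hc)) hs

theorem dense_iff (t : OrderedTree) :
    Dense t ↔
      ∀ v : List ℕ, t.IsVertex v → t.IsLeaf v ∨ ∃ u : List ℕ, t.Adj v u ∧ t.IsLeaf u := by
  rw [leaf_or_adj_leaf_iff]
  exact ⟨Dense.forall_subtreeAt, Dense.of_forall_subtreeAt t⟩

theorem numEdges_nil : numEdges (node []) = 0 := by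
  rw [numEdges]; rfl

theorem numEdges_cons (t : OrderedTree) (ts : List OrderedTree) :
    numEdges (node (t :: ts)) = numEdges t + 1 + numEdges (node ts) := by
  rw [numEdges, numEdges]; simp

end OrderedTree

/-! ### Forests and their codes -/

open OrderedTree

/-- The forest with a given code: at least one tree of it is a single vertex for a code in
`Code false`, and none is for a code in `Code true`. -/
def Code.toForest : {b : Bool} → Code b → List OrderedTree
  | _, .nil false => [node []]
  | _, .nil true => []
  | _, .single p => node [] :: p.toForest
  | _, .double p q => node q.toForest :: p.toForest
  | _, .split e p => node [] :: node p.toForest :: e.toForest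
  | _, .cons e p => node p.toForest :: e.toForest

theorem Code.leaf_mem_toForest {b : Bool} (c : Code b) : node [] ∈ c.toForest ↔ b = false := by
  induction c with
  | nil b => cases b <;> simp [toForest]
  | single p _ => simp [toForest]
  | double p q hp _ => simp [toForest, hp]
  | split e p _ _ => simp [toForest]
  | cons e p he hp =>
    have : p.toForest ≠ [] := fun h => by simp [h] at hp
    simp [toForest, he, this]

theorem Code.toForest_ne_nil (c : Code false) : c.toForest ≠ [] :=
  List.ne_nil_of_mem (c.leaf_mem_toForest.2 rfl)

/-- Two features of a forest tell the constructors apart: whether its first tree is a single vertex,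
and whether the remaining trees include one. -/
theorem Code.toForest_injective {b : Bool} (c c' : Code b) (h : c.toForest = c'.toForest) :
    c = c' := by
  induction c with
  | nil b =>
    cases c' with
    | nil => rfl
    | single p => simp [toForest, p.toForest_ne_nil.symm] at h
    | double p q => simp [toForest, p.toForest_ne_nil.symm] at h
    | split e p => simp [toForest] at h
    | cons e p => simp [toForest] at h
  | single p hp =>
    cases c' with
    | nil => simp [toForest, p.toForest_ne_nil] at h
    | single p' => simp only [toForest, List.cons.injEq, true_and] at h; rw [hp _ h]
    | double p' q' => simp [toForest, q'.toForest_ne_nil.symm] at h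
    | split e' p' =>
      simp only [toForest, List.cons.injEq, true_and] at h
      have := p.leaf_mem_toForest.2 rfl
      simp [h, e'.leaf_mem_toForest, p'.toForest_ne_nil] at this
  | double p q hp hq =>
    cases c' with
    | nil => simp [toForest, p.toForest_ne_nil] at h
    | single p' => simp [toForest, q.toForest_ne_nil] at h
    | double p' q' =>
      simp only [toForest, List.cons.injEq, node.injEq] at h
      rw [hp _ h.2, hq _ h.1]
    | split e' p' => simp [toForest, q.toForest_ne_nil] at h
  | split e p he hp =>
    cases c' with
    | nil => simp [toForest] at h
    | single p' =>
      simp only [toForest, List.cons.injEq, true_and] at h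
      have := p'.leaf_mem_toForest.2 rfl
      simp [← h, e.leaf_mem_toForest, p.toForest_ne_nil] at this
    | double p' q' => simp [toForest, q'.toForest_ne_nil.symm] at h
    | split e' p' =>
      simp only [toForest, List.cons.injEq, node.injEq, true_and] at h
      rw [he _ h.2, hp _ h.1]
  | cons e p he hp =>
    cases c' with
    | nil => simp [toForest] at h
    | cons e' p' =>
      simp only [toForest, List.cons.injEq, node.injEq] at h
      rw [he _ h.2, hp _ h.1]

/-- The extra 1 is the edge to the leaf of `nil false`, which has size 0. -/
theorem Code.numEdges_toForest {b : Bool} (c : Code b) :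
    numEdges (node c.toForest) = c.size + if b then 0 else 1 := by
  induction c with
  | nil b => cases b <;> simp [toForest, size, numEdges_nil, numEdges_cons]
  | _ =>
    simp_all only [toForest, size, numEdges_nil, numEdges_cons, if_true, if_false,
      Bool.false_eq_true]
    try omega

theorem Code.dense_toForest {b : Bool} (c : Code b) : ∀ t ∈ c.toForest, Dense t := by
  have key (p : Code false) (h : ∀ t ∈ p.toForest, Dense t) : Dense (node p.toForest) :=
    .inner _ (p.leaf_mem_toForest.2 rfl) h
  induction c with
  | nil b => cases b <;> simp [toForest, Dense.leaf]
  | single p hp => simpa [toForest, Dense.leaf] using hp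
  | double p q hp hq => simpa [toForest, key q hq] using hp
  | split e p he hp => simpa [toForest, key p hp, Dense.leaf] using he
  | cons e p he hp => simpa [toForest, key p hp] using he

/-- Both classes go through one induction, since removing the first tree can remove the only leaf.
-/
theorem Code.exists_toForest_eq (n : ℕ) (ts : List OrderedTree) (hn : numEdges (node ts) ≤ n)
    (h : ∀ t ∈ ts, Dense t) :
    (node [] ∈ ts → ∃ c : Code false, c.toForest = ts) ∧
      (node [] ∉ ts → ∃ c : Code true, c.toForest = ts) := by
  induction n using Nat.strong_induction_on generalizing ts with
  | _ n ih =>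
  cases ts with
  | nil => exact ⟨by simp, fun _ => ⟨.nil true, rfl⟩⟩
  | cons t r =>
    rw [numEdges_cons] at hn
    have hr := ih _ (by omega) r le_rfl fun t ht => h t (by simp [ht])
    cases h t (by simp) with
    | leaf =>
      refine ⟨fun _ => ?_, fun h => by simp at h⟩
      by_cases hm : node [] ∈ r
      · obtain ⟨c, rfl⟩ := hr.1 hm
        exact ⟨.single c, rfl⟩
      -- The leading leaf is the only one: what follows is empty or starts with a larger tree.
      · obtain ⟨c, rfl⟩ := hr.2 hm
        cases c with
        | nil => exact ⟨.nil false, rfl⟩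
        | cons e p => exact ⟨.split e p, rfl⟩
    | inner cs hl hcs =>
      obtain ⟨q, rfl⟩ := (ih _ (by omega) cs le_rfl hcs).1 hl
      simp only [List.mem_cons, node.injEq, q.toForest_ne_nil.symm, false_or]
      refine ⟨fun hm => ?_, fun hm => ?_⟩
      · obtain ⟨c, rfl⟩ := hr.1 hm
        exact ⟨.double c q, rfl⟩
      · obtain ⟨c, rfl⟩ := hr.2 hm
        exact ⟨.cons c q, rfl⟩

theorem ncard_dense_trees (n : ℕ) :
    Set.ncard {t : OrderedTree | t.numEdges = n + 1 ∧ Dense t} =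
      Set.ncard {c : Code false | c.size = n} := by
  have hinj : Function.Injective fun c : Code false => node c.toForest :=
    fun c c' h => c.toForest_injective c' (node.inj h)
  rw [← Set.ncard_image_of_injective _ hinj]
  congr 1
  ext t
  constructor
  · rintro ⟨hn, ht⟩
    cases ht with
    | leaf => simp [numEdges_nil] at hn
    | inner cs hl h =>
      obtain ⟨c, rfl⟩ := (Code.exists_toForest_eq _ cs le_rfl h).1 hl
      rw [c.numEdges_toForest] at hn
      exact ⟨c, by simpa using hn, rfl⟩
  · rintro ⟨c, rfl, rfl⟩
    exact ⟨by simp [c.numEdges_toForest],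
      .inner _ (c.leaf_mem_toForest.2 rfl) c.dense_toForest⟩


/-! ### Marked words -/

/-- A step of a Dyck path whose north steps are grouped into blocks of size one or two: a north
step is a block of its own, or the first or the second step of a block. -/
inductive Mark : Type
  | single : Mark
  | first : Mark
  | second : Mark
  | east : Mark

/-- What precedes a position of a marked word: nothing that restricts the next step, the first
step of a block whose second step is missing, or the last step of a block. -/
inductive Phase : Type
  | ready : Phase
  | pending : Phase
  | closed : Phase

/-- The phase after one more step, if that step is allowed. -/
def Phase.next : Phase → Mark → Option Phase
  | .ready, .east => some .ready
  | .ready, .single => some .closed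
  | .ready, .first => some .pending
  | .pending, .east => some .pending
  | .pending, .second => some .closed
  | .closed, .east => some .ready
  | _, _ => none

/-- The phase after a word, if that word is allowed. -/
def Phase.run : Phase → List Mark → Option Phase
  | q, [] => some q
  | q, x :: w => (q.next x).bind fun q => q.run w

theorem Phase.run_append (q : Phase) (u v : List Mark) :
    q.run (u ++ v) = (q.run u).bind fun q => q.run v := by
  induction u generalizing q with
  | nil => rfl
  | cons x u ih =>
    simp only [List.cons_append, run]
    cases q.next x with
    | none => rfl
    | some q => exact ih q

/-- The word leads from height `h` to height `0` without going below height `0`. -/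
def Balanced : ℕ → List Mark → Prop
  | h, [] => h = 0
  | 0, .east :: _ => False
  | h + 1, .east :: w => Balanced h w
  | h, .single :: w => Balanced (h + 1) w
  | h, .first :: w => Balanced (h + 1) w
  | h, .second :: w => Balanced (h + 1) w

theorem balanced_cons_north {x : Mark} (hx : x ≠ .east) (h : ℕ) (w : List Mark) :
    Balanced h (x :: w) ↔ Balanced (h + 1) w := by
  cases x <;> simp_all [Balanced]

theorem balanced_append {h : ℕ} {u : List Mark} (hu : Balanced h u) (k : ℕ) (v : List Mark) :
    Balanced (h + k) (u ++ v) ↔ Balanced k v := by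
  induction u generalizing h with
  | nil =>
    obtain rfl : h = 0 := hu
    simp
  | cons x u ih =>
    by_cases hx : x = .east
    · subst hx
      cases h with
      | zero => exact hu.elim
      | succ h =>
        rw [Nat.add_right_comm]
        exact ih hu
    · rw [balanced_cons_north hx] at hu
      rw [List.cons_append, balanced_cons_north hx, Nat.add_right_comm]
      exact ih hu

theorem balanced_zero_append {u : List Mark} (hu : Balanced 0 u) (k : ℕ) (v : List Mark) :
    Balanced k (u ++ v) ↔ Balanced k v := by
  simpa using balanced_append hu k v

/-- The word `u` descends by `k + 1` in total, so from height `k` it falls below 0. -/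
theorem not_balanced_append {k : ℕ} {u : List Mark} (hu : Balanced (k + 1) u) (v : List Mark) :
    ¬ Balanced k (u ++ v) := by
  induction u generalizing k with
  | nil => cases hu
  | cons x u ih =>
    by_cases hx : x = .east
    · subst hx
      cases k with
      | zero => exact id
      | succ k => exact ih (k := k) hu
    · rw [balanced_cons_north hx] at hu
      rw [List.cons_append, balanced_cons_north hx]
      exact ih hu

theorem Balanced.ne_east {x : Mark} {w : List Mark} (h : Balanced 0 (x :: w)) : x ≠ .east := by
  rintro rfl
  exact h

/-- A nonempty word ending at height 0 without having gone below ends with an east step, and no east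
step leads to `closed`. -/
theorem Balanced.eq_nil_of_run_closed {h : ℕ} {w : List Mark} {q : Phase} (hw : Balanced h w)
    (hq : q.run w = some .closed) : w = [] := by
  induction w generalizing h q with
  | nil => rfl
  | cons x w ih =>
    exfalso
    simp only [Phase.run, Option.bind_eq_some_iff] at hq
    obtain ⟨q', h1, h2⟩ := hq
    by_cases hx : x = .east
    · subst hx
      cases h with
      | zero => exact hw
      | succ h =>
        obtain rfl := ih (h := h) hw h2
        cases q <;> simp_all [Phase.next, Phase.run]
    · rw [balanced_cons_north hx] at hw
      obtain rfl := ih hw h2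
      cases hw

/-- Decomposition at the first step below the starting height. -/
theorem Balanced.exists_first {h : ℕ} {w : List Mark} (hw : Balanced (h + 1) w) :
    ∃ u v, w = u ++ .east :: v ∧ Balanced 0 u ∧ Balanced h v := by
  obtain ⟨n, hn⟩ : ∃ n, w.length = n := ⟨_, rfl⟩
  induction n using Nat.strong_induction_on generalizing h w with
  | _ n ih =>
  cases w with
  | nil => cases hw
  | cons x w =>
    by_cases hx : x = .east
    · subst hx
      exact ⟨[], w, rfl, rfl, hw⟩
    · rw [balanced_cons_north hx] at hw
      -- The north step raised the height to `h + 2`: one descent closes that step, the second is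
      -- the one sought.
      obtain ⟨u, v, rfl, hu, hv⟩ := ih _ (by simp at hn; omega) hw rfl
      obtain ⟨u', v', rfl, hu', hv'⟩ := ih _ (by simp at hn; omega) hv rfl
      refine ⟨x :: (u ++ .east :: u'), v', by simp, ?_, hv'⟩
      rw [balanced_cons_north hx, balanced_zero_append hu]
      exact hu'

theorem Balanced.exists_first_return {x : Mark} {w : List Mark} (hw : Balanced 0 (x :: w)) :
    ∃ u v, w = u ++ .east :: v ∧ Balanced 0 u ∧ Balanced 0 v :=
  ((balanced_cons_north hw.ne_east _ _).1 hw).exists_first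

/-- Decomposition at the last step away from height `0`. -/
theorem Balanced.exists_last_return {w : List Mark} (hw : Balanced 0 w) (hne : w ≠ []) :
    ∃ u x v, w = u ++ x :: (v ++ [.east]) ∧ x ≠ .east ∧ Balanced 0 u ∧ Balanced 0 v := by
  obtain ⟨n, hn⟩ : ∃ n, w.length = n := ⟨_, rfl⟩
  induction n using Nat.strong_induction_on generalizing w with
  | _ n ih =>
  cases w with
  | nil => exact absurd rfl hne
  | cons x w =>
    obtain ⟨u, v, rfl, hu, hv⟩ := hw.exists_first_return
    by_cases hv0 : v = []
    · subst hv0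
      exact ⟨[], x, u, rfl, hw.ne_east, rfl, hu⟩
    · obtain ⟨u', y, v', rfl, hy, hu', hv'⟩ := ih _ (by simp at hn ⊢; omega) hv hv0 rfl
      refine ⟨x :: (u ++ .east :: u'), y, v', by simp, hy, ?_, hv'⟩
      rw [balanced_cons_north hw.ne_east, balanced_zero_append hu]
      exact hu'

/-- If the cuts differed, the longer prefix would contain the shorter one followed by an east step
from height 0. -/
theorem Balanced.first_unique {u v u' v' : List Mark} (hu : Balanced 0 u) (hu' : Balanced 0 u')
    (h : u ++ .east :: v = u' ++ .east :: v') : u = u' ∧ v = v' := by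
  rcases List.append_eq_append_iff.1 h with ⟨a, rfl, ha⟩ | ⟨a, rfl, ha⟩
  · cases a with
    | nil => simpa using ha
    | cons x a =>
      simp only [List.cons_append, List.cons.injEq] at ha
      rw [balanced_zero_append hu, ← ha.1] at hu'
      exact hu'.elim
  · cases a with
    | nil => simpa [eq_comm] using ha
    | cons x a =>
      simp only [List.cons_append, List.cons.injEq] at ha
      rw [balanced_zero_append hu', ← ha.1] at hu
      exact hu.elim

/-- If the cuts differed, the suffix after the earlier one would begin with a piece of total descent
one, so it would not be balanced. -/
theorem Balanced.last_unique {x : Mark} (hx : x ≠ .east) {u v u' v' : List Mark}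
    (hu : Balanced 0 u) (hu' : Balanced 0 u') (hv : Balanced 0 v) (hv' : Balanced 0 v')
    (h : u ++ x :: v = u' ++ x :: v') : u = u' ∧ v = v' := by
  rcases List.append_eq_append_iff.1 h with ⟨a, rfl, ha⟩ | ⟨a, rfl, ha⟩
  · cases a with
    | nil => simpa using ha
    | cons y a =>
      simp only [List.cons_append, List.cons.injEq] at ha
      obtain ⟨rfl, rfl⟩ := ha
      rw [balanced_zero_append hu, balanced_cons_north hx] at hu'
      exact absurd hv (not_balanced_append hu' _)
  · cases a with
    | nil => simpa [eq_comm] using ha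
    | cons y a =>
      simp only [List.cons_append, List.cons.injEq] at ha
      obtain ⟨rfl, rfl⟩ := ha
      rw [balanced_zero_append hu', balanced_cons_north hx] at hu
      exact absurd hv' (not_balanced_append hu _)

/-! ### Marked words and their codes -/

/-- The marked word with a given code. -/
def Code.toWord : {b : Bool} → Code b → List Mark
  | _, .nil _ => []
  | _, .single p => .single :: .east :: p.toWord
  | _, .double p q => .first :: (.second :: .east :: p.toWord ++ .east :: q.toWord)
  | _, .split e p => .first :: (e.toWord ++ .east :: .second :: .east :: p.toWord)
  | _, .cons e p => .second :: .east :: (p.toWord ++ .first :: (e.toWord ++ [.east]))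

theorem Code.balanced_toWord {b : Bool} (c : Code b) : Balanced 0 c.toWord := by
  induction c with
  | nil => exact rfl
  | single p hp => exact hp
  | double p q hp hq => simpa [toWord, Balanced, balanced_zero_append hp] using hq
  | split e p he hp => simpa [toWord, Balanced, balanced_zero_append he] using hp
  | cons e p he hp =>
    simp [toWord, Balanced, balanced_zero_append he, balanced_zero_append hp]

/-- The phase before and after the words with codes in `Code b`. -/
def Phase.ofBool : Bool → Phase
  | false => .ready
  | true => .pending

theorem Code.run_toWord {b : Bool} (c : Code b) :
    (Phase.ofBool b).run c.toWord = some (Phase.ofBool b) := by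
  induction c with
  | nil => rfl
  | single p hp => exact hp
  | double p q hp hq =>
    simp_all [toWord, Phase.run, Phase.run_append, Phase.ofBool, Phase.next]
  | split e p he hp =>
    simp_all [toWord, Phase.run, Phase.run_append, Phase.ofBool, Phase.next]
  | cons e p he hp =>
    simp_all [toWord, Phase.run, Phase.run_append, Phase.ofBool, Phase.next]

/-- The part before the first return, run from `pending`, ends in `ready` for the one and in
`pending` for the other. -/
theorem Code.double_ne_split (p q : Code false) (e : Code true) (p' : Code false) :
    (Code.double p q).toWord ≠ (Code.split e p').toWord := by
  intro h
  have hp : Balanced 0 (Mark.second :: .east :: p.toWord) := p.balanced_toWord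
  have h1 := (hp.first_unique e.balanced_toWord (List.cons.inj h).2).1
  have h2 := e.run_toWord
  have h3 := p.run_toWord
  simp only [← h1, Phase.ofBool, Phase.run, Phase.next, Option.bind_some] at h2 h3
  simp [h3] at h2

theorem Code.toWord_injective {b : Bool} (c c' : Code b) (h : c.toWord = c'.toWord) :
    c = c' := by
  induction c with
  | nil => cases c' <;> simp [toWord] at h ⊢
  | single p hp =>
    cases c' with
    | single p' =>
      simp only [toWord, List.cons.injEq, true_and] at h
      rw [hp _ h]
    | _ => simp [toWord] at h
  | double p q hp hq =>
    cases c' with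
    | double p' q' =>
      simp only [toWord, List.cons_append, List.cons.injEq, true_and] at h
      obtain ⟨h1, h2⟩ := p.balanced_toWord.first_unique p'.balanced_toWord h
      rw [hp _ h1, hq _ h2]
    | split e' p' => exact absurd h (double_ne_split _ _ _ _)
    | _ => simp [toWord] at h
  | split e p he hp =>
    cases c' with
    | double p' q' => exact absurd h.symm (double_ne_split _ _ _ _)
    | split e' p' =>
      simp only [toWord, List.cons.injEq, true_and] at h
      obtain ⟨h1, h2⟩ := e.balanced_toWord.first_unique e'.balanced_toWord h
      simp only [List.cons.injEq, true_and] at h2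
      rw [he _ h1, hp _ h2]
    | _ => simp [toWord] at h
  | cons e p he hp =>
    cases c' with
    | nil => simp [toWord] at h
    | cons e' p' =>
      simp only [toWord, List.cons.injEq, true_and] at h
      rw [← List.cons_append, ← List.cons_append, ← List.append_assoc, ← List.append_assoc,
        List.append_left_inj] at h
      obtain ⟨h1, h2⟩ := Balanced.last_unique (by simp) p.balanced_toWord p'.balanced_toWord
        e.balanced_toWord e'.balanced_toWord h
      rw [he _ h2, hp _ h1]

/-- A balanced word after a completed block is empty, since otherwise it would start with a north
step. -/
theorem Balanced.eq_nil_of_closed_run {w : List Mark} {q : Phase} (hw : Balanced 0 w)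
    (hq : Phase.closed.run w = some q) : w = [] := by
  cases w with
  | nil => rfl
  | cons x w => cases x <;> simp [Phase.run, Phase.next, Balanced] at hq hw

/-- A nonempty balanced word after the first step of a block starts with the second step. -/
theorem Balanced.exists_of_pending_run {w : List Mark} {q : Phase} (hw : Balanced 0 w)
    (hne : w ≠ []) (hq : Phase.pending.run w = some q) :
    ∃ v, w = .second :: .east :: v ∧ Balanced 0 v ∧ Phase.ready.run v = some q := by
  cases w with
  | nil => exact absurd rfl hne
  | cons x w =>
    obtain ⟨u, v, rfl, hu, hv⟩ := hw.exists_first_return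
    cases x with
    | second =>
      simp only [Phase.run, Phase.next, Option.bind_some, Phase.run_append,
        Option.bind_eq_some_iff] at hq
      obtain ⟨q', h1, q'', h2, h3⟩ := hq
      obtain rfl := hu.eq_nil_of_closed_run h1
      cases h1
      cases h2
      exact ⟨v, rfl, hv, h3⟩
    | _ => simp [Phase.run, Phase.next, Balanced] at hq hw

/-- For words from `ready`, the first return is used, and the phase reached just before it chooses
between `double` and `split`. Words from `pending` start by completing the block, and the last
return of the rest isolates the new open block. -/
theorem Code.exists_toWord_eq (n : ℕ) (w : List Mark) (hn : w.length ≤ n) (hw : Balanced 0 w) :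
    (Phase.ready.run w = some .ready → ∃ c : Code false, c.toWord = w) ∧
      (Phase.pending.run w = some .pending → ∃ c : Code true, c.toWord = w) := by
  induction n using Nat.strong_induction_on generalizing w with
  | _ n ih =>
  by_cases hne : w = []
  · subst hne
    exact ⟨fun _ => ⟨.nil _, rfl⟩, fun _ => ⟨.nil _, rfl⟩⟩
  constructor
  · intro hr
    cases w with
    | nil => exact absurd rfl hne
    | cons x w =>
      obtain ⟨u, v, rfl, hu, hv⟩ := hw.exists_first_return
      simp only [List.length_cons, List.length_append] at hn
      simp only [Phase.run, Phase.run_append, Option.bind_eq_some_iff] at hr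
      obtain ⟨q1, h1, q2, h2, q3, h3, h4⟩ := hr
      cases x with
      | east => exact hw.elim
      | second => cases h1
      | single =>
        cases h1
        obtain rfl := hu.eq_nil_of_closed_run h2
        cases h2
        cases h3
        obtain ⟨c, rfl⟩ := (ih _ (by simp at hn ⊢; omega) v le_rfl hv).1 h4
        exact ⟨.single c, rfl⟩
      | first =>
        cases h1
        cases q2 with
        | closed =>
          obtain rfl := hu.eq_nil_of_run_closed h2
          cases h2
        | ready =>
          cases h3
          have hu0 : u ≠ [] := by rintro rfl; cases h2
          obtain ⟨u, rfl, hu', h2'⟩ := hu.exists_of_pending_run hu0 h2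
          simp only [List.length_cons] at hn
          obtain ⟨c, rfl⟩ := (ih _ (by omega) u le_rfl hu').1 h2'
          obtain ⟨c', rfl⟩ := (ih _ (by omega) v le_rfl hv).1 h4
          exact ⟨.double c c', rfl⟩
        | pending =>
          cases h3
          have hv0 : v ≠ [] := by rintro rfl; cases h4
          obtain ⟨v, rfl, hv', h4'⟩ := hv.exists_of_pending_run hv0 h4
          simp only [List.length_cons] at hn
          obtain ⟨c, rfl⟩ := (ih _ (by omega) u le_rfl hu).2 h2
          obtain ⟨c', rfl⟩ := (ih _ (by omega) v le_rfl hv').1 h4'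
          exact ⟨.split c c', rfl⟩
  · intro hr
    obtain ⟨w, rfl, hw', hr⟩ := hw.exists_of_pending_run hne hr
    have hw0 : w ≠ [] := by rintro rfl; cases hr
    obtain ⟨u, x, v, rfl, hx, hu, hv⟩ := hw'.exists_last_return hw0
    simp only [List.length_cons, List.length_append] at hn
    simp only [Phase.run, Phase.run_append, Option.bind_eq_some_iff] at hr
    obtain ⟨q1, h1, q2, h2, q3, h3, q4, h4, h5⟩ := hr
    cases h5
    -- An east step leads to `pending` only from `pending`.
    have hq3 : q3 = .pending := by cases q3 <;> simp_all [Phase.next]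
    subst hq3
    cases q2 with
    | closed =>
      obtain rfl := hv.eq_nil_of_closed_run h3
      cases h3
    | ready => cases q1 <;> cases x <;> simp_all [Phase.next]
    | pending =>
      obtain ⟨rfl, rfl⟩ : q1 = .ready ∧ x = .first := by
        cases q1 <;> cases x <;> simp_all [Phase.next]
      obtain ⟨c, rfl⟩ := (ih _ (by omega) u le_rfl hu).1 h1
      obtain ⟨c', rfl⟩ := (ih _ (by omega) v le_rfl hv).2 h3
      exact ⟨.cons c' c, rfl⟩


/-! ### Layered words -/

/-- The word is a decreasing sequence of blocks of one or two letters, where the blocks are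
intervals of integers in increasing order. -/
inductive Layered : List ℕ → Prop
  | nil : Layered []
  | one (l : List ℕ) : Layered l → Layered ((l.length + 1) :: l)
  | two (l : List ℕ) : Layered l → Layered ((l.length + 1) :: (l.length + 2) :: l)

theorem Layered.perm {l : List ℕ} (h : Layered l) : l.Perm (List.range' 1 l.length) := by
  induction h with
  | nil => exact .nil
  | one l _ ih =>
    rw [List.length_cons, List.range'_1_concat, Nat.add_comm 1]
    exact (ih.cons _).trans (List.perm_append_singleton _ _).symm
  | two l _ ih =>
    rw [List.length_cons, List.length_cons, List.range'_1_concat, List.range'_1_concat,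
      Nat.add_comm 1, Nat.add_comm 1, Nat.add_assoc]
    exact (List.Perm.swap _ _ _).trans
      ((((ih.cons _).trans (List.perm_append_singleton _ _).symm).cons _).trans
        (List.perm_append_singleton _ _).symm)

theorem Layered.le_length {l : List ℕ} (h : Layered l) {x : ℕ} (hx : x ∈ l) : x ≤ l.length := by
  have := h.perm.mem_iff.1 hx
  rw [List.mem_range'_1] at this
  omega

/-- Every letter is larger than all later letters except possibly the next one. -/
def SkipDecreasing (l : List ℕ) : Prop :=
  ∀ i j (hj : j < l.length) (hij : i + 1 < j), l[j] < l[i]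

theorem SkipDecreasing.tail {a : ℕ} {l : List ℕ} (h : SkipDecreasing (a :: l)) :
    SkipDecreasing l :=
  fun i j hj hij => h (i + 1) (j + 1) (by simpa using hj) (by omega)

theorem SkipDecreasing.lt {a b : ℕ} {l : List ℕ} (h : SkipDecreasing (a :: b :: l)) {x : ℕ}
    (hx : x ∈ l) : x < a := by
  obtain ⟨i, hi, rfl⟩ := List.mem_iff_getElem.1 hx
  exact h 0 (i + 2) (by simpa using hi) (by omega)

theorem SkipDecreasing.cons {a : ℕ} {l : List ℕ} (h : SkipDecreasing l)
    (ha : ∀ x ∈ l.tail, x < a) : SkipDecreasing (a :: l) := by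
  intro i j hj hij
  obtain ⟨j, rfl⟩ : ∃ k, j = k + 2 := ⟨j - 2, by omega⟩
  cases i with
  | zero =>
    refine ha _ ?_
    rw [List.getElem_cons_succ, ← List.getElem_tail (h := by simp at hj ⊢; omega)]
    exact List.getElem_mem _
  | succ i => exact h i (j + 1) (Nat.lt_of_succ_lt_succ hj) (by omega)

theorem Layered.skipDecreasing {l : List ℕ} (h : Layered l) : SkipDecreasing l := by
  induction h with
  | nil => intro i j hj; simp at hj
  | one l h ih =>
    exact ih.cons fun x hx => Nat.lt_succ_of_le (h.le_length (List.mem_of_mem_tail hx))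
  | two l h ih =>
    refine (ih.cons fun x hx => ?_).cons fun x hx => Nat.lt_succ_of_le (h.le_length hx)
    have := h.le_length (List.mem_of_mem_tail hx)
    omega

/-- The largest letter is in first or second place. If it is second, the next largest must be first,
since it cannot come after a smaller first letter at distance two or more. Remove this block and
repeat. -/
theorem SkipDecreasing.layered (n : ℕ) (l : List ℕ) (hl : l.Perm (List.range' 1 n))
    (h : SkipDecreasing l) : Layered l := by
  induction n using Nat.strong_induction_on generalizing l with
  | _ n ih =>
  have hlen : l.length = n := by simpa using hl.length_eq
  have hmem (x : ℕ) : x ∈ l ↔ 1 ≤ x ∧ x ≤ n := by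
    rw [hl.mem_iff, List.mem_range'_1]; omega
  have hnd : l.Nodup := hl.nodup_iff.2 List.nodup_range'
  cases l with
  | nil => exact .nil
  | cons a l =>
    simp only [List.length_cons] at hlen
    subst hlen
    rw [List.range'_1_concat] at hl
    by_cases ha : a = l.length + 1
    · subst ha
      have hl' : l.Perm (List.range' 1 l.length) := by
        rw [Nat.add_comm 1] at hl
        exact (hl.trans (List.perm_append_singleton _ _)).cons_inv
      exact .one l (ih _ (by omega) l hl' h.tail)
    · cases l with
      | nil =>
        have := (hmem a).1 (by simp)
        simp at this ha
        omega
      | cons b l =>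
        simp only [List.length_cons] at *
        have htop : l.length + 2 = b := by
          have := (hmem (l.length + 2)).2 (by omega)
          simp only [List.mem_cons] at this
          rcases this with h1 | h1 | h1
          · omega
          · exact h1
          · have h2 := h.lt h1
            have h3 := (hmem a).1 (by simp)
            omega
        subst htop
        have hnext : l.length + 1 = a := by
          have := (hmem (l.length + 1)).2 (by omega)
          simp only [List.mem_cons] at this
          rcases this with h1 | h1 | h1
          · exact h1
          · omega
          · have h2 := h.lt h1
            have h3 := (hmem a).1 (by simp)
            omega
        subst hnext
        have hl' : l.Perm (List.range' 1 l.length) := by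
          rw [List.range'_1_concat] at hl
          have := ((List.Perm.swap _ _ _).trans hl).trans (List.perm_append_singleton _ _)
          rw [show 1 + (l.length + 1) = l.length + 2 by omega] at this
          have := this.cons_inv.trans (List.perm_append_singleton _ _)
          rw [Nat.add_comm 1] at this
          exact this.cons_inv
        exact .two l (ih _ (by omega) l hl' h.tail.tail)

theorem contains_of_three {w ρ : List ℕ} {x y z : ℕ} (hρ : ρ = [x, y, z]) {i j k : ℕ} (hij : i < j)
    (hjk : j < k) (hk : k < w.length)
    (hxy : w[i] ≤ w[j] ↔ x ≤ y) (hyx : w[j] ≤ w[i] ↔ y ≤ x)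
    (hxz : w[i] ≤ w[k] ↔ x ≤ z) (hzx : w[k] ≤ w[i] ↔ z ≤ x)
    (hyz : w[j] ≤ w[k] ↔ y ≤ z) (hzy : w[k] ≤ w[j] ↔ z ≤ y) : Contains w ρ := by
  subst hρ
  refine ⟨![⟨i, by omega⟩, ⟨j, by omega⟩, ⟨k, hk⟩], ?_, ?_⟩
  · intro a b hab
    fin_cases a <;> fin_cases b <;> simp_all
    omega
  · intro a b
    fin_cases a <;> fin_cases b <;> simp_all

/-- Given a violation at `i + 1 < j`, position `i + 1` serves as the middle entry, and its relative
value decides which of the three patterns occurs. -/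
theorem avoids_iff_skipDecreasing {l : List ℕ} (hl : l.Nodup) :
    (∀ ρ ∈ [[1, 2, 3], [1, 3, 2], [2, 1, 3]], Avoids l ρ) ↔ SkipDecreasing l := by
  constructor
  · intro h i j hj hij
    by_contra! hle
    have hne {a b : ℕ} (ha : a < l.length) (hb : b < l.length) (hab : a ≠ b) : l[a] ≠ l[b] :=
      fun h => hab ((hl.getElem_inj_iff).1 h)
    have h1 : l[i] ≠ l[j] := hne (by omega) hj (by omega)
    have h2 : l[i] ≠ l[i + 1] := hne (by omega) (by omega) (by omega)
    have h3 : l[i + 1] ≠ l[j] := hne (by omega) hj (by omega)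
    rcases lt_or_gt_of_ne h2 with h2 | h2
    · rcases lt_or_gt_of_ne h3 with h3 | h3
      · exact h [1, 2, 3] (by simp) (contains_of_three rfl (i := i) (j := i + 1) (by omega) hij hj
          (by omega) (by omega) (by omega) (by omega) (by omega) (by omega))
      · exact h [1, 3, 2] (by simp) (contains_of_three rfl (i := i) (j := i + 1) (by omega) hij hj
          (by omega) (by omega) (by omega) (by omega) (by omega) (by omega))
    · exact h [2, 1, 3] (by simp) (contains_of_three rfl (i := i) (j := i + 1) (by omega) hij hj
          (by omega) (by omega) (by omega) (by omega) (by omega) (by omega))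
  · intro h ρ hρ
    have key (x y z : ℕ) (hxz : x ≤ z) : Avoids l [x, y, z] := by
      rintro ⟨f, hf, hw⟩
      have h1 : f (0 : Fin 3) < f (1 : Fin 3) := hf (show (0 : Fin 3) < 1 by decide)
      have h2 : f (1 : Fin 3) < f (2 : Fin 3) := hf (show (1 : Fin 3) < 2 by decide)
      have h3 : l[(f (0 : Fin 3)).1] ≤ l[(f (2 : Fin 3)).1] :=
        (hw (0 : Fin 3) (2 : Fin 3)).2 hxz
      rw [Fin.lt_def] at h1 h2
      exact absurd h3 (not_le.2 (h _ _ (f (2 : Fin 3)).2 (by omega)))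
    simp only [List.mem_cons, List.not_mem_nil, or_false] at hρ
    rcases hρ with rfl | rfl | rfl <;> exact key _ _ _ (by decide)

theorem layered_iff (l : List ℕ) :
    Layered l ↔ l.Perm (List.range' 1 l.length) ∧
      ∀ ρ ∈ [[1, 2, 3], [1, 3, 2], [2, 1, 3]], Avoids l ρ := by
  constructor
  · intro h
    exact ⟨h.perm, (avoids_iff_skipDecreasing
      (h.perm.nodup_iff.2 List.nodup_range')).2 h.skipDecreasing⟩
  · rintro ⟨h, ha⟩
    exact SkipDecreasing.layered _ l h
      ((avoids_iff_skipDecreasing (h.nodup_iff.2 List.nodup_range')).1 ha)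


/-! ### Labeling marked words -/

/-- The labeled step that replaces a mark in front of a path with `m` north steps. -/
def Mark.toStep (m : ℕ) : Mark → Step
  | .single => .north (m + 1)
  | .first => .north m
  | .second => .north (m + 2)
  | .east => .east

/-- The labeled path of a marked word, whose blocks are labeled decreasingly and whose labels
increase by one within a block. -/
def toPath : List Mark → List Step
  | [] => []
  | x :: w => x.toStep (labels (toPath w)).length :: toPath w

theorem Mark.toStep_injective (m : ℕ) : Function.Injective (Mark.toStep m) := by
  intro x y h
  cases x <;> cases y <;> simp [toStep] at h ⊢

theorem toPath_injective : Function.Injective toPath := by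
  intro u v h
  induction u generalizing v with
  | nil =>
    cases v with
    | nil => rfl
    | cons y v => simp [toPath] at h
  | cons x u ih =>
    cases v with
    | nil => simp [toPath] at h
    | cons y v =>
      simp only [toPath, List.cons.injEq] at h
      obtain rfl := ih h.2
      rw [Mark.toStep_injective _ h.1]

theorem labels_north (a : ℕ) (p : List Step) : labels (.north a :: p) = a :: labels p := rfl

theorem labels_east (p : List Step) : labels (.east :: p) = labels p := rfl

theorem numNorth_north (a : ℕ) (p : List Step) : numNorth (.north a :: p) = numNorth p + 1 := by
  simp [numNorth, Step.isEast]

theorem numNorth_east (p : List Step) : numNorth (.east :: p) = numNorth p := by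
  simp [numNorth, Step.isEast]

theorem numEast_north (a : ℕ) (p : List Step) : numEast (.north a :: p) = numEast p :=
  List.countP_cons_of_neg (by simp [Step.isEast])

theorem numEast_east (p : List Step) : numEast (.east :: p) = numEast p + 1 :=
  List.countP_cons_of_pos rfl

theorem length_labels (p : List Step) : (labels p).length = numNorth p := by
  induction p with
  | nil => rfl
  | cons s p ih =>
    cases s with
    | north a => rw [labels_north, numNorth_north, List.length_cons, ih]
    | east => rw [labels_east, numNorth_east, ih]

/-- The labels increase along consecutive north steps. -/
def IncreasingLabels (p : List Step) : Prop :=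
  ∀ (q r : List Step) (a b : ℕ), p = q ++ .north a :: .north b :: r → a < b

theorem IncreasingLabels.tail {s : Step} {p : List Step} (h : IncreasingLabels (s :: p)) :
    IncreasingLabels p :=
  fun q r a b hp => h (s :: q) r a b (by rw [hp]; rfl)

theorem IncreasingLabels.east_cons {p : List Step} (h : IncreasingLabels p) :
    IncreasingLabels (.east :: p) := by
  intro q r a b hp
  cases q with
  | nil => simp at hp
  | cons s q => exact h q r a b (List.cons.inj hp).2

theorem IncreasingLabels.north_cons {p : List Step} (h : IncreasingLabels p) {a : ℕ}
    (ha : ∀ b r, p = .north b :: r → a < b) : IncreasingLabels (.north a :: p) := by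
  intro q r c d hp
  cases q with
  | nil =>
    simp only [List.nil_append, List.cons.injEq, Step.north.injEq] at hp
    rw [← hp.1]
    exact ha _ _ hp.2
  | cons s q => exact h q r c d (List.cons.inj hp).2

/-- The paths that can follow a given phase. -/
def Follows : Phase → List Step → Prop
  | .ready, p => Layered (labels p)
  | .pending, p => ∃ l, Layered l ∧ labels p = (l.length + 2) :: l
  | .closed, p => Layered (labels p) ∧ ∀ a r, p ≠ .north a :: r

/-- Labels depend only on the north steps to the right, so the induction builds the path from its
end. A final `pending` would leave a block without its second label. -/
theorem follows_toPath {q : Phase} {w : List Mark} {q' : Phase} (h : q.run w = some q')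
    (hq' : q' ≠ .pending) : Follows q (toPath w) ∧ IncreasingLabels (toPath w) := by
  induction w generalizing q with
  | nil =>
    cases h
    refine ⟨?_, fun q r a b h => by simp [toPath] at h⟩
    cases q' with
    | ready => exact .nil
    | pending => exact absurd rfl hq'
    | closed => exact ⟨.nil, fun a r h => by cases h⟩
  | cons x w ih =>
    simp only [Phase.run, Option.bind_eq_some_iff] at h
    obtain ⟨q1, h1, h2⟩ := h
    obtain ⟨hf, hi⟩ := ih h2
    cases q <;> cases x <;> cases h1
    · exact ⟨.one _ hf.1, hi.north_cons fun b r h => absurd h (hf.2 _ _)⟩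
    · obtain ⟨l, hl, hw⟩ := hf
      refine ⟨?_, hi.north_cons fun b r h => ?_⟩
      · simp only [Follows, toPath, Mark.toStep, labels_north, hw]
        exact .two l hl
      · rw [h, labels_north, List.cons.injEq] at hw
        rw [h, labels_north, hw.1, hw.2]
        simp
    · exact ⟨hf, hi.east_cons⟩
    · exact ⟨⟨_, hf.1, rfl⟩, hi.north_cons fun b r h => absurd h (hf.2 _ _)⟩
    · exact ⟨hf, hi.east_cons⟩
    · exact ⟨⟨hf, fun a r h => by cases h⟩, hi.east_cons⟩

theorem exists_toPath_eq {q : Phase} {p : List Step} (hf : Follows q p)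
    (hi : IncreasingLabels p) :
    ∃ w q', toPath w = p ∧ q.run w = some q' ∧ q' ≠ .pending := by
  induction p generalizing q with
  | nil =>
    refine ⟨[], q, rfl, rfl, ?_⟩
    rintro rfl
    obtain ⟨l, -, h⟩ := hf
    cases h
  | cons s p ih =>
    have step (x : Mark) (q1 : Phase) (hx : q.next x = some q1) (hf1 : Follows q1 p)
        (hs : x.toStep (labels p).length = s) :
        ∃ w q', toPath w = s :: p ∧ q.run w = some q' ∧ q' ≠ .pending := by
      obtain ⟨w, q', rfl, hr, hq'⟩ := ih hf1 hi.tail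
      exact ⟨x :: w, q', by rw [toPath, hs], by simp [Phase.run, hx, hr], hq'⟩
    -- A north step right after a completed block would carry a label at most the number of
    -- remaining labels, hence below `a`, against the increase along consecutive north steps.
    have closed {a : ℕ} (hs : s = .north a) (hl : Layered (labels p))
        (ha : (labels p).length < a) : Follows .closed p := by
      refine ⟨hl, ?_⟩
      rintro b r rfl
      subst hs
      have h1 := hi [] r a b rfl
      have h2 := hl.le_length (x := b) (by simp [labels_north])
      omega
    cases s with
    | east =>
      cases q with
      | ready => exact step .east .ready rfl hf rfl
      | pending => exact step .east .pending rfl hf rfl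
      | closed => exact step .east .ready rfl hf.1 rfl
    | north a =>
      cases q with
      | ready =>
        simp only [Follows, labels_north] at hf
        generalize hm : labels p = m at hf
        cases hf with
        | one l hl =>
          subst hm
          exact step .single .closed rfl (closed rfl hl (by omega)) rfl
        -- The labels that follow include the second one of the block, so their number is `l.length
        -- + 1`, the label itself.
        | two l hl => exact step .first .pending rfl ⟨l, hl, hm⟩ (by simp [hm, Mark.toStep])
      | pending =>
        obtain ⟨l, hl, h⟩ := hf
        rw [labels_north, List.cons.injEq] at h
        obtain ⟨rfl, rfl⟩ := h
        exact step .second .closed rfl (closed rfl hl (by omega)) rfl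
      | closed => exact absurd rfl (hf.2 a p)

theorem balanced_iff (h : ℕ) (w : List Mark) :
    Balanced h w ↔ numEast (toPath w) = numNorth (toPath w) + h ∧
      ∀ q : List Step, q <+: toPath w → numEast q ≤ numNorth q + h := by
  induction w generalizing h with
  | nil =>
    simp only [Balanced, toPath, List.prefix_nil, forall_eq]
    simp [numEast, numNorth, eq_comm]
  | cons x w ih =>
    have hpre (s : Step) : (∀ q : List Step, q <+: s :: toPath w → numEast q ≤ numNorth q + h) ↔
        ∀ q : List Step, q <+: toPath w → numEast (s :: q) ≤ numNorth (s :: q) + h := by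
      constructor
      · exact fun H q hq => H _ (List.cons_prefix_cons.2 ⟨rfl, hq⟩)
      · intro H q hq
        rcases List.prefix_cons_iff.1 hq with rfl | ⟨q', rfl, hq'⟩
        · simp [numEast]
        · exact H q' hq'
    by_cases hx : x = .east
    · subst hx
      simp only [toPath, Mark.toStep]
      rw [hpre]
      simp only [numEast_east, numNorth_east]
      cases h with
      | zero =>
        refine ⟨False.elim, fun H => ?_⟩
        have := H.2 [] List.nil_prefix
        simp [numEast, numNorth] at this
      | succ h =>
        refine (ih h).trans (and_congr (by omega) (forall₂_congr fun q _ => by omega))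
    · obtain ⟨a, ha⟩ : ∃ a, x.toStep (labels (toPath w)).length = .north a := by
        cases x <;> simp_all [Mark.toStep]
      rw [balanced_cons_north hx, toPath, ha, hpre, ih]
      simp only [numEast_north, numNorth_north]
      exact and_congr (by omega) (forall₂_congr fun q _ => by omega)

theorem numNorth_toPath_append (u v : List Mark) :
    numNorth (toPath (u ++ v)) = numNorth (toPath u) + numNorth (toPath v) := by
  induction u with
  | nil => simp [toPath, numNorth]
  | cons x u ih =>
    cases x <;>
      simp only [List.cons_append, toPath, Mark.toStep, numNorth_north, numNorth_east, ih] <;>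
      omega

theorem Code.numNorth_toPath_toWord {b : Bool} (c : Code b) :
    numNorth (toPath c.toWord) = c.size := by
  have h : numNorth [] = 0 := rfl
  induction c with
  | nil => rfl
  | _ =>
    simp_all only [toWord, size, numNorth_toPath_append, toPath, Mark.toStep, numNorth_north,
      numNorth_east, List.cons_append]
    try omega

/-! ### Counting the avoiding parking functions by codes -/

theorem isParkingFunction_and_avoids_iff (n : ℕ) (p : List Step) :
    (IsParkingFunction n p ∧ ∀ ρ ∈ [[1, 2, 3], [1, 3, 2], [2, 1, 3]], Avoids (labels p) ρ) ↔
      numNorth p = n ∧ numEast p = n ∧ (∀ q : List Step, q <+: p → numEast q ≤ numNorth q) ∧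
        Layered (labels p) ∧ IncreasingLabels p := by
  constructor
  · rintro ⟨⟨h1, h2, h3, h4, h5⟩, h6⟩
    refine ⟨h1, h2, h3, (layered_iff _).2 ⟨?_, h6⟩, h5⟩
    rwa [length_labels, h1]
  · rintro ⟨h1, h2, h3, h4, h5⟩
    obtain ⟨h4, h6⟩ := (layered_iff _).1 h4
    refine ⟨⟨h1, h2, h3, ?_, h5⟩, h6⟩
    rwa [length_labels, h1] at h4

theorem pf_eq_ncard_code (n : ℕ) :
    pf n [[1, 2, 3], [1, 3, 2], [2, 1, 3]] = Set.ncard {c : Code false | c.size = n} := by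
  have hinj : Function.Injective fun c : Code false => toPath c.toWord :=
    fun c c' h => c.toWord_injective c' (toPath_injective h)
  rw [← Set.ncard_image_of_injective _ hinj, pf]
  congr 1
  ext p
  rw [Set.mem_ofPred_eq, isParkingFunction_and_avoids_iff]
  constructor
  · rintro ⟨h1, h2, h3, h4, h5⟩
    obtain ⟨w, q, rfl, hr, hq⟩ := exists_toPath_eq (q := .ready) h4 h5
    have hb : Balanced 0 w := (balanced_iff 0 w).2 ⟨by omega, h3⟩
    -- A balanced word ending in `closed` is empty, but the empty word stays in `ready`.
    have hready : q = .ready := by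
      cases q with
      | ready => rfl
      | pending => exact absurd rfl hq
      | closed =>
        obtain rfl := hb.eq_nil_of_run_closed hr
        cases hr
    subst hready
    obtain ⟨c, rfl⟩ := (Code.exists_toWord_eq _ w le_rfl hb).1 hr
    exact ⟨c, c.numNorth_toPath_toWord.symm.trans h1, rfl⟩
  · rintro ⟨c, rfl, rfl⟩
    obtain ⟨h1, h2⟩ := (balanced_iff 0 _).1 c.balanced_toWord
    obtain ⟨h3, h4⟩ := follows_toPath c.run_toWord (by simp [Phase.ofBool])
    have := c.numNorth_toPath_toWord
    exact ⟨this, by rw [← this, h1, Nat.add_zero], h2, h3, h4⟩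

end PatternParking

theorem theoremT (n : ℕ) :
    PatternParking.pf n [[1, 2, 3], [1, 3, 2], [2, 1, 3]] =
      Set.ncard {t : PatternParking.OrderedTree | t.numEdges = n + 1 ∧
        ∀ v : List ℕ, t.IsVertex v → t.IsLeaf v ∨ ∃ u : List ℕ, t.Adj v u ∧ t.IsLeaf u} := by
  simp only [PatternParking.pf_eq_ncard_code, ← PatternParking.ncard_dense_trees,
    PatternParking.OrderedTree.dense_iff]
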